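/- Let $k,n\ge 0$ be integers. Given inputs $x_1,\dots,x_k\in\{0,1\}^n$, a modified equality query $\mathrm{MEQ}_{k,n}(i,j,y,z)$, with $i,j\in\{1,\dots,k\}$ and $y,z\in\{0,1\}^n$, asks whether $x_i\oplus y=x_j\oplus z$. An $\mathrm{MEQ}_{k,n}$ decision tree with outputs in a set $S$ is a finite rooted binary tree in which every inner node has two children and is labeled by such a query, and every leaf is labeled by an element of $S$. It is evaluated from the root, moving to the right child if the answer to the query at the current node is yes and to the left child otherwise, and it outputs the label of the leaf that is reached. Its depth is the maximum number of inner nodes on a path from the root to a leaf. In a quantum $k$-party simultaneous message-passing ($\mathsf{SMP}$) protocol without shared randomness or entanglement, each player $\ell\in\{1,\dots,k\}$ sends to a referee a quantum state $|\psi_\ell(x_\ell)\rangle$ of $q_\ell$ qubits that depends only on that player's own input $x_\ell$. The referee measures the joint state $|\psi_1(x_1)\rangle\otimes\cdots\otimes|\psi_k(x_k)\rangle$ by a quantum measurement that does not depend on the inputs, and outputs an element of $S$ determined by the outcome. The protocol uses $\sum_{\ell=1}^k q_\ell$ qubits. It implements a decision tree with error probability at most $\delta$ if, for every input $(x_1,\dots,x_k)$,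 the probability that the referee's output differs from the output of the tree is at most $\delta$. **Theorem.** There is a universal constant $C>0$ such that for all integers $n,k,D\ge 0$, every $\delta\in(0,1)$, every set $S$ and every $\mathrm{MEQ}_{k,n}$ decision tree of depth $D$ with outputs in $S$, there is a quantum $k$-party $\mathsf{SMP}$ protocol without shared randomness or entanglement that implements the tree with error probability at most $\delta$ and uses at most $$C\,k\,\bigl(\log \max(D,1)+\log(1/\delta)\bigr)\,\log\max(n,2)$$ qubits; that is, $O\bigl(k(\log D+\log(1/\delta))\log n\bigr)$ qubits. -/

import Mathlib

/-- Bit strings of length `n`. -/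
abbrev BitStr (n : ℕ) : Type := Fin n → Bool

/-- Bitwise exclusive or. -/
def BitStr.bxor {n : ℕ} (x y : BitStr n) : BitStr n := fun t => xor (x t) (y t)

/-- The modified equality query `MEQ_{k,n}(i, j, y, z)` on the inputs `x`:
is `x_i ⊕ y = x_j ⊕ z`? -/
def meq {k n : ℕ} (x : Fin k → BitStr n) (i j : Fin k) (y z : BitStr n) : Bool :=
  decide ((x i).bxor y = (x j).bxor z)

/-- `MEQ_{k,n}` decision trees with outputs in `S`: binary trees whose inner nodes are labeled by
queries `(i, j, y, z)` and whose leaves are labeled by elements of `S`. -/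
inductive MEQTree (k n : ℕ) (S : Type*) where
  | leaf (s : S) : MEQTree k n S
  | node (i j : Fin k) (y z : BitStr n) (left right : MEQTree k n S) : MEQTree k n S

namespace MEQTree

/-- The depth: the largest number of queries on a path from the root to a leaf. -/
def depth {k n : ℕ} {S : Type*} : MEQTree k n S → ℕ
  | leaf _ => 0
  | node _ _ _ _ left right => max left.depth right.depth + 1

/-- The output of the tree: go right if the answer to the query is 1, left if it is 0. -/
def eval {k n : ℕ} {S : Type*} (x : Fin k → BitStr n) : MEQTree k n S → S
  | leaf s => s
  | node i j y z left right => if meq x i j y z = true then right.eval x else left.eval x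

end MEQTree

/-- The state space of a register of `q` qubits, of dimension `2 ^ q`, with the computational basis
indexed by bit strings. -/
abbrev Register (q : ℕ) : Type := EuclideanSpace ℂ (BitStr q)

open scoped ComplexOrder in
/-- A quantum `k`-party simultaneous message-passing protocol with inputs in `{0,1}^n` and outputs
in `S`, without shared randomness or entanglement. The message of player `ℓ` is a state of
`qubits ℓ` qubits that depends on the input of that player only. The referee performs a general
quantum measurement with finitely many outcomes (a POVM) on the joint register of all messages and
outputs a function of the outcome. -/
structure QuantumSMP (k n : ℕ) (S : Type*) where
  /-- the number of qubits sent by each player -/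
  qubits : Fin k → ℕ
  /-- the message of each player, as a function of the player's own input -/
  message : (ℓ : Fin k) → BitStr n → Register (qubits ℓ)
  norm_message : ∀ ℓ x, ‖message ℓ x‖ = 1
  /-- the number of outcomes of the referee's measurement -/
  outcomes : ℕ
  /-- the referee's measurement operators on the joint register -/
  effect : Fin outcomes →
    Matrix ((ℓ : Fin k) → BitStr (qubits ℓ)) ((ℓ : Fin k) → BitStr (qubits ℓ)) ℂ
  effect_posSemidef : ∀ ω, (effect ω).PosSemidef
  sum_effect : ∑ ω, effect ω = 1
  /-- the output of the referee for each measurement outcome -/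
  output : Fin outcomes → S

namespace QuantumSMP

variable {k n : ℕ} {S : Type*}

/-- The communication cost: the total number of qubits sent to the referee. -/
def cost (P : QuantumSMP k n S) : ℕ := ∑ ℓ, P.qubits ℓ

/-- The joint state received by the referee: the tensor product of the messages, written in the
computational basis. -/
noncomputable def jointState (P : QuantumSMP k n S) (x : Fin k → BitStr n) :
    ((ℓ : Fin k) → BitStr (P.qubits ℓ)) → ℂ :=
  fun b => ∏ ℓ, P.message ℓ (x ℓ) (b ℓ)

/-- The probability `⟨ψ| E_ω |ψ⟩` of the measurement outcome `ω` on the inputs `x`. -/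
noncomputable def outcomeProb (P : QuantumSMP k n S) (x : Fin k → BitStr n)
    (ω : Fin P.outcomes) : ℝ :=
  (star (P.jointState x) ⬝ᵥ (P.effect ω).mulVec (P.jointState x)).re

open Classical in
/-- The probability that, on the inputs `x`, the referee's output is different from `s`. -/
noncomputable def errorProb (P : QuantumSMP k n S) (x : Fin k → BitStr n) (s : S) : ℝ :=
  ∑ ω with P.output ω ≠ s, P.outcomeProb x ω

end QuantumSMP

/-! Every player sends `2 * s` copies of a fingerprint of the input, and the referee runs the tree
on them, reusing the same copies for every query. Fingerprints are superpositions over the graph of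
the polynomial with coefficients `x` over a field with `2 ^ r ≥ 2 * n` elements: distinct inputs
overlap by at most 1/2, and adding a bit string to the input permutes the basis.

Hence `x_i ⊕ y = x_j ⊕ z` says that the joint state is fixed by the involution exchanging registers
`i` and `j` and shifting both by `y ⊕ z`. A swap test for this involution on every copy always
accepts if the answer is yes, and accepts with probability at most `(3/4) ^ (2 * s)` if it is no
(`Fingerprint.l2norm_yesProj_mulVec_copies_sq_le`). A wrong answer thus has amplitude at most `(3/4)
^ s`, so each correct answer moves the state by at most that much. Along a path these displacements
add up (`MEQTree.exists_povm`), and the total error is at most `2 * D * (3/4) ^ s`. It suffices to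
take `s` of order `log D + log (1/δ)`. -/

/-! ### Norms and projections -/

/-- The Euclidean norm of a finitely indexed complex vector. -/
noncomputable def l2norm {ι : Type*} [Fintype ι] (v : ι → ℂ) : ℝ :=
  ‖(WithLp.toLp 2 v : EuclideanSpace ℂ ι)‖

section L2Norm

variable {ι : Type*} [Fintype ι]

theorem l2norm_nonneg (v : ι → ℂ) : 0 ≤ l2norm v := norm_nonneg _

theorem l2norm_sq (v : ι → ℂ) : l2norm v ^ 2 = (star v ⬝ᵥ v).re := by
  rw [l2norm, EuclideanSpace.norm_sq_eq, dotProduct, Complex.re_sum]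
  refine Finset.sum_congr rfl fun i _ => ?_
  simp [Complex.sq_norm, Complex.normSq_apply]

theorem l2norm_zero : l2norm (0 : ι → ℂ) = 0 := by simp [l2norm]

theorem l2norm_sub_le (u v w : ι → ℂ) : l2norm (u - w) ≤ l2norm (u - v) + l2norm (v - w) := by
  simp only [l2norm, WithLp.toLp_sub]
  exact norm_sub_le_norm_sub_add_norm_sub _ _ _

theorem l2norm_sub_le_l2norm_sub (u v : ι → ℂ) : l2norm u - l2norm v ≤ l2norm (u - v) := by
  simp only [l2norm, WithLp.toLp_sub]
  exact norm_sub_norm_le _ _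

theorem star_dotProduct_conjTranspose_mul_mulVec (A B : Matrix ι ι ℂ) (v : ι → ℂ) :
    star v ⬝ᵥ ((A.conjTranspose * B).mulVec v) = star (A.mulVec v) ⬝ᵥ (B.mulVec v) := by
  rw [← Matrix.mulVec_mulVec, Matrix.dotProduct_mulVec, Matrix.star_mulVec]

theorem IsStarProjection.l2norm_mulVec_sq {P : Matrix ι ι ℂ} (hP : IsStarProjection P)
    (v : ι → ℂ) : l2norm (P.mulVec v) ^ 2 = (star v ⬝ᵥ P.mulVec v).re := by
  have h : P.conjTranspose * P = P := by
    rw [← Matrix.star_eq_conjTranspose, hP.isSelfAdjoint.star_eq, hP.isIdempotentElem.eq]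
  rw [l2norm_sq, ← star_dotProduct_conjTranspose_mul_mulVec, h]

variable [DecidableEq ι]

theorem IsStarProjection.l2norm_mulVec_le {P : Matrix ι ι ℂ} (hP : IsStarProjection P)
    (v : ι → ℂ) : l2norm (P.mulVec v) ≤ l2norm v := by
  refine abs_le_of_sq_le_sq' ?_ (l2norm_nonneg v) |>.2
  -- Pythagoras: the part of `v` removed by `P` has squared norm `‖v‖² - ‖Pv‖²`.
  have h := hP.one_sub.l2norm_mulVec_sq v
  rw [Matrix.sub_mulVec, Matrix.one_mulVec, dotProduct_sub, Complex.sub_re, ← l2norm_sq,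
    ← hP.l2norm_mulVec_sq] at h
  linarith [sq_nonneg (l2norm (v - P.mulVec v))]

end L2Norm

/-! ### Sequential measurement along a decision tree -/

open scoped ComplexOrder in
/-- Performing the queries of a decision tree one after the other by two-outcome projective
measurements is a POVM. If all the measurements that give the wrong answer on `x` have small
amplitude on `v`, then the outcome of the leaf reached on `x` has an operator that hardly
disturbs `v`. -/
theorem MEQTree.exists_povm {k n : ℕ} {S ι : Type*} [Fintype ι] [DecidableEq ι]
    (proj : Fin k → Fin k → BitStr n → BitStr n → Matrix ι ι ℂ)
    (hproj : ∀ i j y z, IsStarProjection (proj i j y z)) (T : MEQTree k n S) :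
    ∃ (N : ℕ) (E : Fin N → Matrix ι ι ℂ) (out : Fin N → S),
      (∀ ω, (E ω).PosSemidef) ∧ ∑ ω, E ω = 1 ∧
      ∀ x, ∃ ω A, E ω = A.conjTranspose * A ∧ out ω = T.eval x ∧
        (∀ v, l2norm (A.mulVec v) ≤ l2norm v) ∧
        ∀ v η, (∀ i j y z, l2norm
            ((if meq x i j y z = true then 1 - proj i j y z else proj i j y z).mulVec v) ≤ η) →
          l2norm (v - A.mulVec v) ≤ T.depth * η := by
  induction T with
  | leaf s =>
    refine ⟨1, fun _ => 1, fun _ => s, fun _ => Matrix.PosSemidef.one, by simp, fun x =>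
      ⟨0, 1, by simp, rfl, by simp, fun v η _ => by simp [depth, l2norm_zero]⟩⟩
  | node i j y z left right ihl ihr =>
    obtain ⟨N₀, E₀, out₀, hE₀, hs₀, h₀⟩ := ihl
    obtain ⟨N₁, E₁, out₁, hE₁, hs₁, h₁⟩ := ihr
    set P := proj i j y z with hPdef
    have hP : IsStarProjection P := hproj i j y z
    have hPH : P.conjTranspose = P := hP.isSelfAdjoint.star_eq
    have hQ : IsStarProjection (1 - P) := hP.one_sub
    have hQH : (1 - P).conjTranspose = 1 - P := hQ.isSelfAdjoint.star_eq
    -- Displacements add, without amplification, because `A` is a contraction: `‖v - ARv‖ ≤ ‖v - Av‖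
    -- + ‖A(v - Rv)‖`. So the hypothesis is only needed for the undisturbed `v`.
    have step : ∀ (A R : Matrix ι ι ℂ) (d : ℕ) (v : ι → ℂ) (η : ℝ),
        (∀ v, l2norm (A.mulVec v) ≤ l2norm v) → l2norm (v - A.mulVec v) ≤ d * η →
        l2norm (v - R.mulVec v) ≤ η → l2norm (v - (A * R).mulVec v) ≤ (d + 1) * η := by
      intro A R d v η hA h hR
      refine (l2norm_sub_le v (A.mulVec v) _).trans ?_
      rw [← Matrix.mulVec_mulVec, ← Matrix.mulVec_sub]
      linarith [hA (v - R.mulVec v)]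
    have mono : ∀ (a b : ℕ) (η : ℝ), a ≤ b → 0 ≤ η → ((a : ℝ) + 1) * η ≤ ((b + 1 : ℕ) : ℝ) * η := by
      intro a b η hab hη
      push_cast
      gcongr
    refine ⟨N₀ + N₁, Fin.append (fun ω => (1 - P).conjTranspose * E₀ ω * (1 - P))
      (fun ω => P.conjTranspose * E₁ ω * P), Fin.append out₀ out₁, ?_, ?_, fun x => ?_⟩
    · intro ω
      refine Fin.addCases (fun ω => ?_) (fun ω => ?_) ω
      · rw [Fin.append_left]; exact (hE₀ ω).conjTranspose_mul_mul_same _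
      · rw [Fin.append_right]; exact (hE₁ ω).conjTranspose_mul_mul_same _
    · rw [Fin.sum_univ_add]
      simp only [Fin.append_left, Fin.append_right]
      rw [← Finset.sum_mul, ← Finset.mul_sum, ← Finset.sum_mul, ← Finset.mul_sum, hs₀, hs₁, hPH,
        hQH, mul_one, mul_one, hQ.isIdempotentElem.eq, hP.isIdempotentElem.eq, sub_add_cancel]
    · by_cases hx : meq x i j y z = true
      · obtain ⟨ω, A, hA, ho, hc, hd⟩ := h₁ x
        refine ⟨Fin.natAdd N₀ ω, A * P, ?_, ?_, fun v => ?_, fun v η hη => ?_⟩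
        · rw [Fin.append_right, hA, Matrix.conjTranspose_mul]; simp only [Matrix.mul_assoc]
        · rw [Fin.append_right, ho, eval, if_pos hx]
        · rw [← Matrix.mulVec_mulVec]; exact (hc _).trans (hP.l2norm_mulVec_le v)
        · have h := hη i j y z
          rw [if_pos hx] at h
          refine (step A P _ v η hc (hd v η hη) ?_).trans
            (mono _ _ η (le_max_right _ _) ((l2norm_nonneg _).trans h))
          simpa [Matrix.sub_mulVec] using h
      · obtain ⟨ω, A, hA, ho, hc, hd⟩ := h₀ x
        refine ⟨Fin.castAdd N₁ ω, A * (1 - P), ?_, ?_, fun v => ?_, fun v η hη => ?_⟩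
        · rw [Fin.append_left, hA, Matrix.conjTranspose_mul]; simp only [Matrix.mul_assoc]
        · rw [Fin.append_left, ho, eval, if_neg hx]
        · rw [← Matrix.mulVec_mulVec]; exact (hc _).trans (hQ.l2norm_mulVec_le v)
        · have h := hη i j y z
          rw [if_neg hx] at h
          refine (step A (1 - P) _ v η hc (hd v η hη) ?_).trans
            (mono _ _ η (le_max_left _ _) ((l2norm_nonneg _).trans h))
          simpa [Matrix.sub_mulVec] using h

/-! ### Tensor powers and the swap test -/

/-- The `t`-fold tensor power of a matrix. -/
def Matrix.tensorPow {ι R : Type*} [CommSemiring R] (t : ℕ) (M : Matrix ι ι R) :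
    Matrix (Fin t → ι) (Fin t → ι) R :=
  fun b b' => ∏ c, M (b c) (b' c)

section TensorPow

variable {ι : Type*} [Fintype ι] {t : ℕ}

theorem sum_pi_prod {α R : Type*} [Fintype α] [DecidableEq α] [CommSemiring R] (f : α → ι → R) :
    ∑ b : α → ι, ∏ c, f c (b c) = ∏ c, ∑ a, f c a := by
  rw [Finset.prod_univ_sum, Fintype.piFinset_univ]

theorem Matrix.tensorPow_mul_tensorPow (M N : Matrix ι ι ℂ) :
    tensorPow t M * tensorPow t N = tensorPow t (M * N) := by
  ext b b'
  simp only [Matrix.mul_apply, tensorPow, ← Finset.prod_mul_distrib]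
  exact sum_pi_prod fun c a => M (b c) a * N a (b' c)

theorem Matrix.tensorPow_mulVec (M : Matrix ι ι ℂ) (φ : ι → ℂ) :
    (tensorPow t M).mulVec (fun b => ∏ c, φ (b c)) = fun b => ∏ c, M.mulVec φ (b c) := by
  ext b
  simp only [Matrix.mulVec, dotProduct, tensorPow, ← Finset.prod_mul_distrib]
  exact sum_pi_prod fun c a => M (b c) a * φ a

theorem IsStarProjection.tensorPow {M : Matrix ι ι ℂ} (hM : IsStarProjection M) :
    IsStarProjection (M.tensorPow t) where
  isIdempotentElem := by
    rw [IsIdempotentElem, Matrix.tensorPow_mul_tensorPow, hM.isIdempotentElem.eq]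
  isSelfAdjoint := by
    have h := hM.isSelfAdjoint.star_eq
    rw [isSelfAdjoint_iff]
    ext b b'
    rw [Matrix.star_apply, Matrix.tensorPow, Matrix.tensorPow, star_prod]
    refine Finset.prod_congr rfl fun c _ => ?_
    rw [← Matrix.star_apply, h]

theorem star_prod_dotProduct_prod (φ χ : ι → ℂ) :
    star (fun b : Fin t → ι => ∏ c, φ (b c)) ⬝ᵥ (fun b => ∏ c, χ (b c)) = (star φ ⬝ᵥ χ) ^ t := by
  simp only [dotProduct, Pi.star_apply, star_prod, ← Finset.prod_mul_distrib]
  rw [sum_pi_prod fun _ a => star (φ a) * χ a]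
  simp

end TensorPow

/-- The projector onto the vectors that are invariant under the involution `s` of the basis. -/
noncomputable def swapTest {ι : Type*} [DecidableEq ι] (s : ι → ι) : Matrix ι ι ℂ :=
  fun a b => ((if b = a then 1 else 0) + (if b = s a then 1 else 0)) / 2

section SwapTest

variable {ι : Type*} [Fintype ι] [DecidableEq ι] {s : ι → ι}

theorem swapTest_mulVec (s : ι → ι) (φ : ι → ℂ) (a : ι) :
    (swapTest s).mulVec φ a = (φ a + φ (s a)) / 2 := by
  simp only [Matrix.mulVec, dotProduct, swapTest, div_mul_eq_mul_div, add_mul, ite_mul, one_mul,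
    zero_mul]
  rw [← Finset.sum_div, Finset.sum_add_distrib]
  simp

theorem isStarProjection_swapTest (hs : Function.Involutive s) :
    IsStarProjection (swapTest s) where
  isIdempotentElem := by
    refine Matrix.mulVec_injective (funext fun φ => funext fun a => ?_)
    rw [← Matrix.mulVec_mulVec]
    simp only [swapTest_mulVec, hs a]
    ring
  isSelfAdjoint := by
    rw [isSelfAdjoint_iff]
    ext a b
    have h : (b = s a) ↔ (a = s b) := ⟨fun h => by rw [h, hs], fun h => by rw [h, hs]⟩
    simp only [Matrix.star_apply, swapTest, star_div₀, star_add, h, eq_comm (a := a) (b := b)]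
    split_ifs <;> simp

end SwapTest

/-! ### Fingerprints from Reed–Solomon codes -/

/-- Real fingerprint states of bit strings on the basis `G`, with the operation of adding a bit
string to the fingerprinted one realized by permutations of the basis. -/
structure Fingerprint (n : ℕ) (G : Type*) [Fintype G] where
  state : BitStr n → G → ℝ
  shift : BitStr n → G → G
  state_nonneg : ∀ x g, 0 ≤ state x g
  sum_state_mul_self : ∀ x, ∑ g, state x g * state x g = 1
  sum_state_mul_le : ∀ x y, x ≠ y → ∑ g, state x g * state y g ≤ 1 / 2
  shift_involutive : ∀ w, Function.Involutive (shift w)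
  state_shift : ∀ x w g, state x (shift w g) = state (x.bxor w) g

/-- Transport of fingerprints along a bijection of the bases. -/
def Fingerprint.congr {n : ℕ} {G H : Type*} [Fintype G] [Fintype H] (f : Fingerprint n G)
    (e : H ≃ G) : Fingerprint n H where
  state x h := f.state x (e h)
  shift w h := e.symm (f.shift w (e h))
  state_nonneg x h := f.state_nonneg x (e h)
  sum_state_mul_self x := by
    rw [← f.sum_state_mul_self x]
    exact e.sum_comp fun g => f.state x g * f.state x g
  sum_state_mul_le x y hxy := by
    refine le_of_eq_of_le ?_ (f.sum_state_mul_le x y hxy)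
    exact e.sum_comp fun g => f.state x g * f.state y g
  shift_involutive w h := by simp [f.shift_involutive w (e h)]
  state_shift x w h := by simp [f.state_shift]

section ReedSolomon

open Polynomial

/-- The polynomial whose coefficients are the bits of `x`. -/
noncomputable def BitStr.toPoly {n : ℕ} (F : Type*) [Field F] (x : BitStr n) : F[X] :=
  ∑ t : Fin n, monomial (t : ℕ) (if x t = true then 1 else 0)

variable {n : ℕ} {F : Type*} [Field F]

theorem BitStr.coeff_toPoly (x : BitStr n) (t : Fin n) :
    (x.toPoly F).coeff t = if x t = true then 1 else 0 := by
  rw [toPoly, finsetSum_coeff, Finset.sum_eq_single t]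
  · simp
  · intro b _ hb
    rw [coeff_monomial, if_neg fun h => hb (Fin.ext h)]
  · simp

theorem BitStr.degree_toPoly_lt (x : BitStr n) : (x.toPoly F).degree < n := by
  refine (degree_sum_le _ _).trans_lt ((Finset.sup_lt_iff (WithBot.bot_lt_coe n)).2 fun t _ => ?_)
  exact (degree_monomial_le _ _).trans_lt (WithBot.coe_lt_coe.2 t.2)

theorem BitStr.toPoly_injective : Function.Injective (BitStr.toPoly (n := n) F) := by
  intro x y h
  ext t
  have h' := congrArg (fun p => coeff p t) h
  simp only [coeff_toPoly] at h'
  cases hx : x t <;> cases hy : y t <;> simp_all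

/-- Characteristic 2 is what makes a shift of the input a translation of the graph, hence an
involution of the basis. -/
theorem BitStr.toPoly_bxor [CharP F 2] (x y : BitStr n) :
    (x.bxor y).toPoly F = x.toPoly F + y.toPoly F := by
  rw [toPoly, toPoly, toPoly, ← Finset.sum_add_distrib]
  refine Finset.sum_congr rfl fun t _ => ?_
  rw [← map_add, bxor]
  cases x t <;> cases y t <;> simp [CharTwo.add_self_eq_zero]

theorem BitStr.card_eval_toPoly_eq_le [Fintype F] [DecidableEq F] {x y : BitStr n} (h : x ≠ y) :
    (Finset.univ.filter fun a : F => (x.toPoly F).eval a = (y.toPoly F).eval a).card ≤ n := by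
  by_contra! hlt
  refine h (BitStr.toPoly_injective (F := F) (eq_of_degrees_lt_of_eval_finset_eq
    (Finset.univ.filter fun a : F => (x.toPoly F).eval a = (y.toPoly F).eval a) ?_ ?_ ?_))
  · exact x.degree_toPoly_lt.trans (WithBot.coe_lt_coe.2 hlt)
  · exact y.degree_toPoly_lt.trans (WithBot.coe_lt_coe.2 hlt)
  · intro a ha
    exact (Finset.mem_filter.1 ha).2

variable (n F) in
/-- The uniform superposition of the points of the graph of the polynomial of `x`. -/
noncomputable def reedSolomonFingerprint [Fintype F] [DecidableEq F] [CharP F 2]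
    (hF : 2 * n ≤ Fintype.card F) : Fingerprint n (F × F) :=
  -- The overlap of two graph states is the fraction of field points where the polynomials agree.
  have key : ∀ x y : BitStr n, ∑ g : F × F,
      (if g.2 = (x.toPoly F).eval g.1 then (√(Fintype.card F))⁻¹ else 0) *
        (if g.2 = (y.toPoly F).eval g.1 then (√(Fintype.card F))⁻¹ else 0) =
      (Finset.univ.filter fun a : F => (x.toPoly F).eval a = (y.toPoly F).eval a).card /
        (Fintype.card F : ℝ) := by
    intro x y
    rw [Fintype.sum_prod_type, Finset.card_filter, Nat.cast_sum, Finset.sum_div]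
    refine Finset.sum_congr rfl fun a _ => ?_
    simp only [ite_mul, zero_mul, Finset.sum_ite_eq', Finset.mem_univ, if_true]
    split_ifs
    · rw [← mul_inv, Real.mul_self_sqrt (Nat.cast_nonneg _), Nat.cast_one, one_div]
    · simp
  have hpos : (0 : ℝ) < Fintype.card F := Nat.cast_pos.2 Fintype.card_pos
  { state := fun x g => if g.2 = (x.toPoly F).eval g.1 then (√(Fintype.card F))⁻¹ else 0
    shift := fun w g => (g.1, g.2 + (w.toPoly F).eval g.1)
    state_nonneg := fun x g => by positivity
    sum_state_mul_self := fun x => by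
      rw [key]
      simp [hpos.ne']
    sum_state_mul_le := fun x y h => by
      rw [key, div_le_iff₀ hpos]
      have h₁ : ((Finset.univ.filter fun a : F =>
          (x.toPoly F).eval a = (y.toPoly F).eval a).card : ℝ) ≤ n :=
        Nat.cast_le.2 (BitStr.card_eval_toPoly_eq_le h)
      have h₂ : (2 * n : ℝ) ≤ Fintype.card F := by exact_mod_cast hF
      linarith
    shift_involutive := fun w g => by
      simp [add_assoc, CharTwo.add_self_eq_zero]
    state_shift := fun x w g => by
      simp only [BitStr.toPoly_bxor, eval_add, CharTwo.add_eq_iff_eq_add] }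

/-- Fingerprints of `n` bits with `O(log n)` qubits. -/
theorem exists_fingerprint (n : ℕ) : ∃ (m : ℕ) (_ : Fingerprint n (BitStr m)),
    (m : ℝ) ≤ 10 * Real.log (max n 2 : ℕ) := by
  classical
  -- One extra bit makes up for the rounding of the logarithm, the other gives the factor 2 in `2 *
  -- n ≤ 2 ^ r`.
  set r := Nat.log 2 (max n 2) + 2 with hr
  have : Fintype (GaloisField 2 r) := Fintype.ofFinite _
  have hcard : Fintype.card (GaloisField 2 r) = 2 ^ r := by
    rw [← Nat.card_eq_fintype_card, GaloisField.card 2 r (by omega)]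
  have hn : 2 * n ≤ Fintype.card (GaloisField 2 r) := by
    have h : max n 2 < 2 ^ (Nat.log 2 (max n 2) + 1) := Nat.lt_pow_succ_log_self one_lt_two _
    have h' : n ≤ max n 2 := le_max_left _ _
    rw [hcard, hr, pow_succ _ (Nat.log 2 (max n 2) + 1)]
    omega
  have : CharP (GaloisField 2 r) 2 := inferInstance
  have e : BitStr (2 * r) ≃ GaloisField 2 r × GaloisField 2 r := Fintype.equivOfCardEq <| by
    rw [Fintype.card_prod, hcard, Fintype.card_fun, Fintype.card_bool, Fintype.card_fin, ← pow_add,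
      two_mul]
  refine ⟨2 * r, (reedSolomonFingerprint n (GaloisField 2 r) hn).congr e, ?_⟩
  have hpow : 2 ^ Nat.log 2 (max n 2) ≤ max n 2 := Nat.pow_log_le_self 2 (by omega)
  have hlog : (Nat.log 2 (max n 2) : ℝ) * Real.log 2 ≤ Real.log (max n 2 : ℕ) := by
    rw [← Real.log_pow]
    exact Real.log_le_log (by positivity) (by exact_mod_cast hpow)
  have htwo : Real.log 2 ≤ Real.log (max n 2 : ℕ) :=
    Real.log_le_log two_pos (by exact_mod_cast le_max_right n 2)
  -- The constant 10 is `2 / 0.6 + 4 / 0.6`, from `2 * r = 2 * Nat.log 2 (max n 2) + 4`.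
  have h06 : (0.6 : ℝ) < Real.log 2 := by linarith [Real.log_two_gt_d9]
  have hnn : (0 : ℝ) ≤ Nat.log 2 (max n 2) := Nat.cast_nonneg _
  have : (Nat.log 2 (max n 2) : ℝ) * 0.6 ≤ Nat.log 2 (max n 2) * Real.log 2 := by gcongr
  rw [hr]
  push_cast at *
  linarith

end ReedSolomon

/-! ### Equality queries as exchange symmetries -/

theorem BitStr.bxor_bxor_self {n : ℕ} (x y : BitStr n) : (x.bxor y).bxor y = x := by
  funext t
  simp [bxor]

theorem BitStr.bxor_eq_bxor_iff {n : ℕ} (a b y z : BitStr n) :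
    a.bxor y = b.bxor z ↔ b.bxor (y.bxor z) = a := by
  simp only [funext_iff, bxor]
  refine forall_congr' fun t => ?_
  cases a t <;> cases b t <;> cases y t <;> cases z t <;> simp

/-- The bit string added to register `ℓ` in the query `(i, j, y, z)`. -/
def queryMask {k n : ℕ} (i j : Fin k) (y z : BitStr n) (ℓ : Fin k) : BitStr n :=
  if ℓ = i ∨ ℓ = j then y.bxor z else fun _ => false

/-- The inputs after exchanging `x_i` and `x_j` and adding `y ⊕ z` to both. -/
def exchangeInputs {k n : ℕ} (i j : Fin k) (y z : BitStr n) (x : Fin k → BitStr n) :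
    Fin k → BitStr n :=
  fun ℓ => (x (Equiv.swap i j ℓ)).bxor (queryMask i j y z ℓ)

/-- Both exchanged registers get the same mask, so shifting commutes with swapping and the exchange
is an involution. -/
theorem queryMask_swap {k n : ℕ} (i j : Fin k) (y z : BitStr n) (ℓ : Fin k) :
    queryMask i j y z (Equiv.swap i j ℓ) = queryMask i j y z ℓ := by
  unfold queryMask
  refine if_congr ?_ rfl rfl
  rw [Equiv.swap_apply_eq_iff, Equiv.swap_apply_eq_iff, Equiv.swap_apply_left,
    Equiv.swap_apply_right, or_comm]

/-- Coordinate `i` of the fixed-point equation is the query itself; coordinate `j` is the same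
equation with the mask moved across. The case `i = j` is included: the query then asks whether `y =
z`. -/
theorem exchangeInputs_eq_iff {k n : ℕ} (i j : Fin k) (y z : BitStr n) (x : Fin k → BitStr n) :
    exchangeInputs i j y z x = x ↔ meq x i j y z = true := by
  rw [meq, decide_eq_true_iff, BitStr.bxor_eq_bxor_iff]
  constructor
  · intro h
    have := congrFun h i
    simpa [exchangeInputs, queryMask] using this
  · intro h
    funext ℓ
    unfold exchangeInputs queryMask
    by_cases hi : ℓ = i
    · subst hi
      simpa using h
    by_cases hj : ℓ = j
    · subst hj
      rw [Equiv.swap_apply_right, if_pos (Or.inr rfl), ← h, BitStr.bxor_bxor_self]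
    · rw [Equiv.swap_apply_of_ne_of_ne hi hj, if_neg (by tauto)]
      funext t
      simp [BitStr.bxor]

namespace Fingerprint

variable {k n : ℕ} {G : Type*} [Fintype G] (f : Fingerprint n G)

/-- The amplitudes of one joint copy of the fingerprints of all inputs. -/
def joint (x : Fin k → BitStr n) (g : Fin k → G) : ℝ := ∏ ℓ, f.state (x ℓ) (g ℓ)

/-- The permutation of the joint basis that exchanges the registers `i` and `j` and shifts both by
`y ⊕ z`. -/
def exchange (i j : Fin k) (y z : BitStr n) (g : Fin k → G) : Fin k → G :=
  fun ℓ => f.shift (queryMask i j y z ℓ) (g (Equiv.swap i j ℓ))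

theorem exchange_involutive (i j : Fin k) (y z : BitStr n) :
    Function.Involutive (f.exchange i j y z) := by
  intro g
  funext ℓ
  simp only [exchange, queryMask_swap, Equiv.swap_apply_self]
  exact f.shift_involutive _ _

theorem joint_exchange (i j : Fin k) (y z : BitStr n) (x : Fin k → BitStr n) (g : Fin k → G) :
    f.joint x (f.exchange i j y z g) = f.joint (exchangeInputs i j y z x) g := by
  unfold joint
  rw [← Equiv.prod_comp (Equiv.swap i j)]
  refine Finset.prod_congr rfl fun ℓ _ => ?_
  rw [exchange, f.state_shift, exchangeInputs, queryMask_swap, Equiv.swap_apply_self]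

theorem sum_joint_mul (x x' : Fin k → BitStr n) :
    ∑ g, f.joint x g * f.joint x' g = ∏ ℓ, ∑ g, f.state (x ℓ) g * f.state (x' ℓ) g := by
  simp only [joint, ← Finset.prod_mul_distrib]
  exact sum_pi_prod fun ℓ g => f.state (x ℓ) g * f.state (x' ℓ) g

theorem sum_joint_mul_self (x : Fin k → BitStr n) : ∑ g, f.joint x g * f.joint x g = 1 := by
  simp [sum_joint_mul, f.sum_state_mul_self]

/-- The overlap is a product over the players; one differing input contributes at most 1/2 and the
other factors are at most 1. -/
theorem sum_joint_mul_le {x x' : Fin k → BitStr n} (h : x ≠ x') :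
    ∑ g, f.joint x g * f.joint x' g ≤ 1 / 2 := by
  obtain ⟨i, hi⟩ := Function.ne_iff.1 h
  have h0 : ∀ ℓ, 0 ≤ ∑ g, f.state (x ℓ) g * f.state (x' ℓ) g := fun ℓ =>
    Finset.sum_nonneg fun g _ => mul_nonneg (f.state_nonneg _ _) (f.state_nonneg _ _)
  have h1 : ∀ ℓ, ∑ g, f.state (x ℓ) g * f.state (x' ℓ) g ≤ 1 := fun ℓ => by
    by_cases hℓ : x ℓ = x' ℓ
    · rw [hℓ, f.sum_state_mul_self]
    · linarith [f.sum_state_mul_le _ _ hℓ]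
  rw [sum_joint_mul, ← Finset.mul_prod_erase _ _ (Finset.mem_univ i)]
  calc _ ≤ (1 / 2 : ℝ) * 1 := mul_le_mul (f.sum_state_mul_le _ _ hi)
        (Finset.prod_le_one (fun ℓ _ => h0 ℓ) fun ℓ _ => h1 ℓ)
        (Finset.prod_nonneg fun ℓ _ => h0 ℓ) (by norm_num)
    _ = 1 / 2 := mul_one _

variable {t : ℕ}

/-- The amplitudes of `t` joint copies of the fingerprints of all inputs. -/
noncomputable def copies (t : ℕ) (x : Fin k → BitStr n) (b : Fin t → Fin k → G) : ℂ :=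
  ∏ c, (f.joint x (b c) : ℂ)

theorem star_joint_dotProduct_joint (x x' : Fin k → BitStr n) :
    star (fun g => (f.joint x g : ℂ)) ⬝ᵥ (fun g => (f.joint x' g : ℂ)) =
      ((∑ g, f.joint x g * f.joint x' g : ℝ) : ℂ) := by
  simp [dotProduct]

theorem l2norm_copies (x : Fin k → BitStr n) : l2norm (f.copies (G := G) t x) = 1 := by
  have h : l2norm (f.copies (G := G) t x) ^ 2 = 1 := by
    rw [l2norm_sq]
    unfold copies
    rw [star_prod_dotProduct_prod (fun g => (f.joint x g : ℂ))
      (fun g => (f.joint x g : ℂ)), star_joint_dotProduct_joint, sum_joint_mul_self]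
    simp
  exact (pow_eq_one_iff_of_nonneg (l2norm_nonneg _) two_ne_zero).1 h

variable [DecidableEq G]

/-- The projector of the answer "yes" to the query `(i, j, y, z)`: the swap test on each of the
`t` copies. -/
noncomputable def yesProj (t : ℕ) (i j : Fin k) (y z : BitStr n) :
    Matrix (Fin t → Fin k → G) (Fin t → Fin k → G) ℂ :=
  (swapTest (f.exchange i j y z)).tensorPow t

theorem isStarProjection_yesProj (i j : Fin k) (y z : BitStr n) :
    IsStarProjection (f.yesProj t i j y z) :=
  (isStarProjection_swapTest (f.exchange_involutive i j y z)).tensorPow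

theorem yesProj_mulVec_copies {i j : Fin k} {y z : BitStr n} {x : Fin k → BitStr n}
    (h : meq x i j y z = true) : (f.yesProj t i j y z).mulVec (f.copies t x) = f.copies t x := by
  unfold yesProj copies
  rw [Matrix.tensorPow_mulVec _ (fun g => (f.joint x g : ℂ))]
  simp only [swapTest_mulVec, joint_exchange, (exchangeInputs_eq_iff i j y z x).2 h, add_self_div_two]

/-- A swap test accepts with probability `(1 + κ) / 2`, where `κ ≤ 1/2` is the overlap with the
exchanged state, and the copies are independent. -/
theorem l2norm_yesProj_mulVec_copies_sq_le {i j : Fin k} {y z : BitStr n} {x : Fin k → BitStr n}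
    (h : ¬ meq x i j y z = true) :
    l2norm ((f.yesProj t i j y z).mulVec (f.copies t x)) ^ 2 ≤ (3 / 4) ^ t := by
  rw [(f.isStarProjection_yesProj i j y z).l2norm_mulVec_sq]
  unfold yesProj copies
  have hx : x ≠ exchangeInputs i j y z x := fun e =>
    h ((exchangeInputs_eq_iff i j y z x).1 e.symm)
  have hmul : (swapTest (f.exchange i j y z)).mulVec (fun g => (f.joint x g : ℂ)) =
      (2⁻¹ : ℂ) • ((fun g => (f.joint x g : ℂ)) +
        fun g => (f.joint (exchangeInputs i j y z x) g : ℂ)) := by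
    funext g
    rw [swapTest_mulVec, joint_exchange]
    simp only [Pi.smul_apply, Pi.add_apply, smul_eq_mul]
    ring
  rw [Matrix.tensorPow_mulVec _ (fun g => (f.joint x g : ℂ)),
    star_prod_dotProduct_prod (fun g => (f.joint x g : ℂ)), hmul, dotProduct_smul,
    dotProduct_add, star_joint_dotProduct_joint, star_joint_dotProduct_joint, sum_joint_mul_self]
  have hle := f.sum_joint_mul_le hx
  have hnn : 0 ≤ ∑ g, f.joint x g * f.joint (exchangeInputs i j y z x) g :=
    Finset.sum_nonneg fun g _ => mul_nonneg (Finset.prod_nonneg fun _ _ => f.state_nonneg _ _)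
      (Finset.prod_nonneg fun _ _ => f.state_nonneg _ _)
  set κ := ∑ g, f.joint x g * f.joint (exchangeInputs i j y z x) g
  have : ((2⁻¹ : ℂ) • (((1 : ℝ) : ℂ) + (κ : ℂ))) ^ t = (((1 + κ) / 2) ^ t : ℝ) := by
    push_cast
    rw [smul_eq_mul]
    congr 1
    ring
  rw [this, Complex.ofReal_re]
  exact pow_le_pow_left₀ (by linarith) (by linarith) t

end Fingerprint

/-! ### The protocols -/

open scoped ComplexOrder in
/-- If every player sends `2 * s` fingerprints, the referee can evaluate the whole tree. -/
theorem MEQTree.exists_fingerprint_protocol {k n m : ℕ} {S : Type*}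
    (f : Fingerprint n (BitStr m)) (s : ℕ) (T : MEQTree k n S) :
    ∃ P : QuantumSMP k n S, P.cost = k * (2 * s * m) ∧
      ∀ x, P.errorProb x (T.eval x) ≤ 2 * T.depth * (3 / 4) ^ s := by
  classical
  obtain ⟨N, E, out, hpos, hsum, hE⟩ := T.exists_povm (f.yesProj (2 * s))
    fun i j y z => f.isStarProjection_yesProj i j y z
  let e : BitStr (2 * s * m) ≃ (Fin (2 * s) → BitStr m) :=
    (Equiv.arrowCongr finProdFinEquiv.symm (Equiv.refl Bool)).trans (Equiv.curry _ _ _)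
  -- Messages are grouped by player, the referee's tests by copy; this bijection of basis indices
  -- regroups them.
  let e' : ((ℓ : Fin k) → BitStr (2 * s * m)) ≃ (Fin (2 * s) → Fin k → BitStr m) :=
    (Equiv.arrowCongr (Equiv.refl _) e).trans (Equiv.piComm _)
  have hnorm : ∀ x, ‖(WithLp.toLp 2 fun b => ∏ c, (f.state x (e b c) : ℂ) :
      Register (2 * s * m))‖ = 1 := by
    intro x
    rw [EuclideanSpace.norm_eq, Real.sqrt_eq_one]
    rw [e.sum_comp fun b => ‖∏ c, (f.state x (b c) : ℂ)‖ ^ 2]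
    have : ∀ b : Fin (2 * s) → BitStr m, ‖∏ c, (f.state x (b c) : ℂ)‖ ^ 2 =
        ∏ c, f.state x (b c) * f.state x (b c) := by
      intro b
      rw [norm_prod, ← Finset.prod_pow]
      refine Finset.prod_congr rfl fun c _ => ?_
      rw [Complex.norm_real, Real.norm_eq_abs, sq_abs, sq]
    simp only [this]
    rw [sum_pi_prod fun _ g => f.state x g * f.state x g]
    simp [f.sum_state_mul_self]
  let P : QuantumSMP k n S :=
    { qubits := fun _ => 2 * s * m
      message := fun _ x => WithLp.toLp 2 fun b => ∏ c, (f.state x (e b c) : ℂ)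
      norm_message := fun _ x => hnorm x
      outcomes := N
      effect := fun ω => (E ω).submatrix e' e'
      effect_posSemidef := fun ω => (hpos ω).submatrix e'
      sum_effect := by
        rw [← Matrix.submatrix_one_equiv e', ← hsum]
        ext a b
        simp [Matrix.sum_apply]
      output := out }
  have hjoint : ∀ x, P.jointState x = f.copies (2 * s) x ∘ e' := by
    intro x
    funext b
    simp only [QuantumSMP.jointState, P, Function.comp, Fingerprint.copies, Fingerprint.joint,
      Complex.ofReal_prod]
    exact Finset.prod_comm
  have hprob : ∀ x ω, P.outcomeProb x ω =
      (star (f.copies (2 * s) x) ⬝ᵥ (E ω).mulVec (f.copies (2 * s) x)).re := by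
    intro x ω
    rw [QuantumSMP.outcomeProb, hjoint]
    have h₁ : (P.effect ω).mulVec (f.copies (2 * s) x ∘ e') =
        (E ω).mulVec (f.copies (2 * s) x) ∘ e' := by
      have := Matrix.submatrix_mulVec_equiv (E ω) (f.copies (2 * s) x ∘ e') e' e'
      simpa [Function.comp_assoc] using this
    rw [h₁]
    congr 1
    exact e'.sum_comp fun b => star (f.copies (2 * s) x) b * (E ω).mulVec (f.copies (2 * s) x) b
  refine ⟨P, ?_, fun x => ?_⟩
  · simp [QuantumSMP.cost, P]
  obtain ⟨ω₀, A, hA, ho, hc, hd⟩ := hE x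
  set ψ := f.copies (2 * s) x with hψ
  have hψ1 : l2norm ψ = 1 := f.l2norm_copies x
  have hprob_nonneg : ∀ ω, 0 ≤ P.outcomeProb x ω := fun ω => by
    rw [hprob]
    exact (Complex.le_def.1 ((hpos ω).dotProduct_mulVec_nonneg ψ)).1
  have htotal : ∑ ω, P.outcomeProb x ω = 1 := by
    simp only [hprob]
    rw [← Complex.re_sum, ← dotProduct_sum, ← Matrix.sum_mulVec, hsum, Matrix.one_mulVec,
      ← l2norm_sq, hψ1, one_pow]
  have hω₀ : P.outcomeProb x ω₀ = l2norm (A.mulVec ψ) ^ 2 := by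
    rw [hprob, hA, star_dotProduct_conjTranspose_mul_mulVec, l2norm_sq]
  -- Every outcome other than the leaf `ω₀` is counted as an error, even if its label happens to be
  -- right.
  have herr : P.errorProb x (T.eval x) ≤ 1 - l2norm (A.mulVec ψ) ^ 2 := by
    rw [← htotal, ← hω₀, ← Finset.sum_erase_eq_sub (Finset.mem_univ ω₀), QuantumSMP.errorProb]
    refine Finset.sum_le_sum_of_subset_of_nonneg (fun ω hω => ?_) fun ω _ _ => hprob_nonneg ω
    refine Finset.mem_erase.2 ⟨?_, Finset.mem_univ _⟩
    rintro rfl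
    exact (Finset.mem_filter.1 hω).2 ho
  have hdist := hd ψ ((3 / 4) ^ s) fun i j y z => by
    split_ifs with h
    · rw [Matrix.sub_mulVec, Matrix.one_mulVec, f.yesProj_mulVec_copies h, sub_self, l2norm_zero]
      positivity
    · refine abs_le_of_sq_le_sq' ?_ (by positivity) |>.2
      rw [← pow_mul, mul_comm s 2]
      exact f.l2norm_yesProj_mulVec_copies_sq_le h
  have hge := l2norm_sub_le_l2norm_sub ψ (A.mulVec ψ)
  rw [hψ1] at hge
  -- With `a = ‖Aψ‖`, `1 - a² = 2(1 - a) - (1 - a)² ≤ 2(1 - a)`.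
  nlinarith [l2norm_nonneg (A.mulVec ψ), sq_nonneg (1 - l2norm (A.mulVec ψ))]

open scoped ComplexOrder in
/-- A single query can be guessed without communication with error probability `1 / 2`. -/
theorem MEQTree.exists_guess_protocol {k n : ℕ} {S : Type*} (T : MEQTree k n S)
    (hT : T.depth = 1) :
    ∃ P : QuantumSMP k n S, P.cost = 0 ∧ ∀ x, P.errorProb x (T.eval x) ≤ 1 / 2 := by
  classical
  obtain ⟨a, b, hab⟩ : ∃ a b, ∀ x, T.eval x = a ∨ T.eval x = b := by
    match T, hT with
    | node i j y z (leaf a) (leaf b), _ =>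
      refine ⟨a, b, fun x => ?_⟩
      simp only [eval]
      split_ifs <;> simp
    | node i j y z (node _ _ _ _ _ _) _, h => simp [depth] at h
    | node i j y z _ (node _ _ _ _ _ _), h => simp [depth] at h
  let P : QuantumSMP k n S :=
    { qubits := fun _ => 0
      message := fun _ _ => EuclideanSpace.single default 1
      norm_message := by simp
      outcomes := 2
      effect := fun _ => (1 / 2 : ℝ) • 1
      effect_posSemidef := fun _ => Matrix.PosSemidef.one.smul (by norm_num)
      sum_effect := by
        rw [Fin.sum_univ_two, ← add_smul]
        norm_num
      output := ![a, b] }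
  have hprob : ∀ x ω, P.outcomeProb x ω = 1 / 2 := by
    intro x ω
    have hj : P.jointState x = 1 := by
      funext c
      refine Finset.prod_eq_one fun ℓ _ => ?_
      have : c ℓ = default := Subsingleton.elim (α := BitStr 0) _ _
      simp [P, this]
    rw [QuantumSMP.outcomeProb, hj]
    simp [P, Matrix.smul_mulVec]
  refine ⟨P, by simp [QuantumSMP.cost, P], fun x => ?_⟩
  rw [QuantumSMP.errorProb]
  simp only [hprob, Finset.sum_const, nsmul_eq_mul]
  -- At least one of the two equally likely guesses is correct.
  have hcard : (Finset.univ.filter fun ω => P.output ω ≠ T.eval x).card ≤ 1 := by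
    have hlt : (Finset.univ.filter fun ω => P.output ω ≠ T.eval x).card <
        (Finset.univ : Finset (Fin 2)).card := by
      refine Finset.card_lt_card (Finset.filter_ssubset.2 ?_)
      rcases hab x with h | h
      · exact ⟨0, Finset.mem_univ _, by simp [P, h]⟩
      · exact ⟨1, Finset.mem_univ _, by simp [P, h]⟩
    simpa using Nat.lt_succ_iff.1 hlt
  have : ((Finset.univ.filter fun ω => P.output ω ≠ T.eval x).card : ℝ) ≤ 1 := by
    exact_mod_cast hcard
  linarith

/-! ### Choice of parameters -/

/-- Number of repetitions that push the error below `δ`. -/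
theorem exists_repetitions {D : ℕ} {δ : ℝ} (hδ : 0 < δ) (hδ1 : δ < 1) (hD : 1 ≤ D)
    (h : D = 1 → δ < 1 / 2) :
    ∃ s : ℕ, 2 * D * (3 / 4 : ℝ) ^ s ≤ δ ∧ (s : ℝ) ≤ 10 * (Real.log D + Real.log (1 / δ)) := by
  have hD0 : (0 : ℝ) < D := by exact_mod_cast hD
  have hD1 : (1 : ℝ) ≤ D := by exact_mod_cast hD
  have hδ' : 1 < 1 / δ := by rwa [lt_div_iff₀ hδ, one_mul]
  have hlogD : 0 ≤ Real.log D := Real.log_nonneg hD1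
  have hlogδ : 0 < Real.log (1 / δ) := Real.log_pos hδ'
  -- This absorbs additive constants into the bound; it would fail for `D = 1` and `δ > 1/2`.
  have hL : Real.log 2 ≤ Real.log D + Real.log (1 / δ) := by
    rcases hD.eq_or_lt with h1 | h2
    · have : Real.log 2 ≤ Real.log (1 / δ) :=
        Real.log_le_log two_pos (by rw [le_div_iff₀ hδ]; linarith [h h1.symm])
      linarith
    · have : Real.log 2 ≤ Real.log D := Real.log_le_log two_pos (by exact_mod_cast h2)
      linarith
  have h06 : (0.6 : ℝ) < Real.log 2 := by linarith [Real.log_two_gt_d9]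
  set M := Real.log 2 + (Real.log D + Real.log (1 / δ)) with hM
  -- Since `exp M = 2 * D / δ` and `3/4 ≤ exp (-1/4)`, `4 * M` repetitions suffice. With `L = log D
  -- + log (1/δ)`, `4 * M + 1 ≤ 8 * L + 1 ≤ 10 * L`.
  refine ⟨⌈4 * M⌉₊, ?_, ?_⟩
  · have hexp : Real.exp M = 2 * D * (1 / δ) := by
      rw [hM, Real.exp_add, Real.exp_add, Real.exp_log two_pos, Real.exp_log hD0,
        Real.exp_log (by positivity), mul_assoc]
    have h34 : (3 / 4 : ℝ) ≤ Real.exp (-(1 / 4)) := by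
      linarith [Real.add_one_le_exp (-(1 / 4) : ℝ)]
    have hle : (3 / 4 : ℝ) ^ ⌈4 * M⌉₊ ≤ Real.exp (-M) := by
      refine (pow_le_pow_left₀ (by norm_num) h34 _).trans ?_
      rw [← Real.exp_nat_mul]
      exact Real.exp_le_exp.2 (by linarith [Nat.le_ceil (4 * M)])
    calc 2 * D * (3 / 4 : ℝ) ^ ⌈4 * M⌉₊ ≤ 2 * D * Real.exp (-M) := by gcongr
      _ = δ := by
        rw [Real.exp_neg, hexp]
        field_simp
  · have := Nat.ceil_lt_add_one (a := 4 * M) (by linarith)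
    linarith

theorem theorem1 :
    ∃ C : ℝ, 0 < C ∧
      ∀ (n k D : ℕ) (δ : ℝ), 0 < δ → δ < 1 →
        ∀ (S : Type*) (T : MEQTree k n S), T.depth = D →
          ∃ P : QuantumSMP k n S,
            (P.cost : ℝ) ≤
              C * (k * (Real.log (max D 1 : ℕ) + Real.log (1 / δ)) * Real.log (max n 2 : ℕ)) ∧
            ∀ x : Fin k → BitStr n, P.errorProb x (T.eval x) ≤ δ := by
  -- 200 is 2 times 10 (repetitions) times 10 (fingerprint length).
  refine ⟨200, by norm_num, fun n k D δ hδ hδ1 S T hT => ?_⟩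
  have hlogD : 0 ≤ Real.log (max D 1 : ℕ) := Real.log_natCast_nonneg _
  have hlogn : 0 ≤ Real.log (max n 2 : ℕ) := Real.log_natCast_nonneg _
  have hlogδ : 0 ≤ Real.log (1 / δ) := Real.log_nonneg (by rw [le_div_iff₀ hδ]; linarith)
  -- For `D = 1` the allowed cost tends to 0 as `δ → 1`, so large `δ` requires a protocol without
  -- communication.
  by_cases hguess : D = 1 ∧ 1 / 2 ≤ δ
  · obtain ⟨P, hcost, herr⟩ := T.exists_guess_protocol (hT.trans hguess.1)
    refine ⟨P, ?_, fun x => (herr x).trans hguess.2⟩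
    rw [hcost, Nat.cast_zero]
    positivity
  obtain ⟨s, hs, hs'⟩ : ∃ s : ℕ, 2 * D * (3 / 4 : ℝ) ^ s ≤ δ ∧
      (s : ℝ) ≤ 10 * (Real.log (max D 1 : ℕ) + Real.log (1 / δ)) := by
    rcases Nat.eq_zero_or_pos D with rfl | hD
    -- A tree of depth 0 is constant and needs no fingerprints.
    · refine ⟨0, by simpa using hδ.le, ?_⟩
      rw [Nat.cast_zero]
      positivity
    · rw [max_eq_left hD]
      exact exists_repetitions hδ hδ1 hD fun h => by
        by_contra! hc
        exact hguess ⟨h, hc⟩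
  obtain ⟨m, f, hm⟩ := exists_fingerprint n
  obtain ⟨P, hcost, herr⟩ := T.exists_fingerprint_protocol f s
  refine ⟨P, ?_, fun x => (herr x).trans (hT ▸ hs)⟩
  rw [hcost]
  push_cast [-Nat.cast_max]
  calc (k : ℝ) * (2 * s * m)
      ≤ k * (2 * (10 * (Real.log (max D 1 : ℕ) + Real.log (1 / δ))) *
          (10 * Real.log (max n 2 : ℕ))) := by gcongr
    _ = _ := by ring
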